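/- Let $r \ge 3$ and $n_1 \ge n_2 \ge \cdots \ge n_r \ge 1$ be integers, and let $K_{n_1,\ldots,n_r}$ be the complete $r$-partite graph with parts of sizes $n_1,\ldots,n_r$. For graphs $G$ and $H$, the anti-Ramsey number $ar(G,H)$ is the maximum $k$ such that there is an edge-coloring of $G$ with exactly $k$ colors containing no rainbow copy of $H$, that is, no subgraph isomorphic to $H$ whose edges all have different colors. Put $$t=\min\left\{\left\lfloor\frac{\sum_{i=1}^{r}n_i}{3}\right\rfloor,\ \left\lfloor\frac{\sum_{i=2}^{r}n_i}{2}\right\rfloor,\ \sum_{i=3}^{r}n_i\right\}.$$ Then $t$ is the maximum number of pairwise vertex-disjoint triangles in $K_{n_1,\ldots,n_r}$, and $$ar(K_{n_1,\ldots,n_r},C_4)=n_1+n_2+\cdots+n_r+t-1,$$ where $C_4$ is the cycle with four vertices. -/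

import Mathlib

/-- A copy `f` of `H` in the edge-colored graph `(G, c)` is rainbow if its edges have pairwise
different colors. -/
def IsRainbowCopy {V W K : Type*} {G : SimpleGraph V} {H : SimpleGraph W}
    (c : G.EdgeLabeling K) (f : SimpleGraph.Copy H G) : Prop :=
  Function.Injective fun e : H.edgeSet => c (f.mapEdgeSet e)

/-- There is an edge-coloring of `G` with exactly `k` colors (every one of the `k` colors is used)
and without a rainbow copy of `H`. -/
def HasRainbowFreeColoring {V W : Type*} (G : SimpleGraph V) (H : SimpleGraph W) (k : ℕ) : Prop :=
  ∃ c : G.EdgeLabeling (Fin k), Function.Surjective c ∧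
    ∀ f : SimpleGraph.Copy H G, ¬ IsRainbowCopy c f

/-- `k` is the anti-Ramsey number `ar(G, H)`: the maximum number of colors in an edge-coloring
of `G` without a rainbow copy of `H`. -/
def IsAntiRamseyNumber {V W : Type*} (G : SimpleGraph V) (H : SimpleGraph W) (k : ℕ) : Prop :=
  IsGreatest {m : ℕ | HasRainbowFreeColoring G H m} k

/-- `G` contains `s` pairwise vertex-disjoint triangles. -/
def HasDisjointTriangles {V : Type*} (G : SimpleGraph V) (s : ℕ) : Prop :=
  ∃ T : Finset (Finset V), T.card = s ∧ (∀ A ∈ T, G.IsNClique 3 A) ∧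
    (T : Set (Finset V)).PairwiseDisjoint id

/-- `t` is the maximum number of pairwise vertex-disjoint triangles of `G`. -/
def IsMaxDisjointTriangles {V : Type*} (G : SimpleGraph V) (t : ℕ) : Prop :=
  IsGreatest {s : ℕ | HasDisjointTriangles G s} t

/-- The complete multipartite graph with parts of sizes `n 0, …, n (r - 1)`. -/
abbrev completeMultipartite {r : ℕ} (n : Fin r → ℕ) :
    SimpleGraph (Σ i : Fin r, Fin (n i)) :=
  SimpleGraph.completeMultipartiteGraph fun i : Fin r => Fin (n i)

/-- The parameter `min {⌊∑ nᵢ / 3⌋, ⌊(∑ nᵢ without the first term) / 2⌋,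
∑ nᵢ without the first two terms}`; the indices start at `0` here and `/` is floor division. -/
def triangleParam {r : ℕ} (n : Fin r → ℕ) : ℕ :=
  min ((∑ i, n i) / 3)
    (min ((∑ i with 1 ≤ (i : Fin r).val, n i) / 2) (∑ i with 2 ≤ (i : Fin r).val, n i))

/-! Upper bound: by induction on `S`, the number of colors on `G[S]` is at most `|S| - 1` plus the
size of some family of disjoint triangles in `G[S]`; of `G` only the transitivity of nonadjacency is
used. In a minimal counterexample, deleting any vertex destroys at least two colors, so every vertex
has two exclusive colors. Without rainbow 4-cycles, the exclusive edges then form a 2-regular graph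
on `S` and have private colors (`exclusive_symm`, `unique_color`, `eq_or_eq`), and the two exclusive
neighbors of a vertex are adjacent. So three consecutive vertices on a cycle of exclusive edges span
a triangle, and deleting it destroys at most four colors (`exists_triangle`): three are paid for by
its vertices, one by the triangle itself.

Lower bound: split the vertices into `t` disjoint triangles and single vertices, and order these
blocks with a triangle last. The edges of the triangles get private colors, an edge between blocks
the color of the lower block. A 4-cycle fits in no block, so at least two of its edges leave its
lowest block, and these have the same color.

For the value of `t`, cut every part down to at most `t` vertices, list the vertices part by part,
and join positions at distance `t` and `2t`. -/

/-! ### Structure of the exclusive edges. -/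

section RainbowFourCycles

variable {V K : Type*}

/-- Every 4-cycle of `G` has two edges with the same value of `c`. -/
def NoRainbowFourCycle (G : SimpleGraph V) (c : V → V → K) : Prop :=
  ∀ a b x d, G.Adj a b → G.Adj b x → G.Adj x d → G.Adj d a → a ≠ x → b ≠ d →
    c a b = c b x ∨ c a b = c x d ∨ c a b = c d a ∨ c b x = c x d ∨ c b x = c d a ∨ c x d = c d a

/-- `vu` is an edge of `G[S]` whose color only occurs in `G[S]` on edges at `v`. -/
def IsExclusiveEdge (G : SimpleGraph V) (c : V → V → K) (S : Finset V) (v u : V) : Prop :=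
  v ∈ S ∧ u ∈ S ∧ G.Adj v u ∧
    ∀ x ∈ S, ∀ y ∈ S, G.Adj x y → c x y = c v u → x = v ∨ y = v

variable {G : SimpleGraph V} {c : V → V → K} {S : Finset V}

/-- Nonadjacency is transitive, the coloring `c` is symmetric without rainbow 4-cycles, and
every vertex of `S` has two colors that only occur at it in `G[S]`. -/
structure HasTwoExclusiveColors (G : SimpleGraph V) (c : V → V → K) (S : Finset V) : Prop where
  trans : ∀ x y z, ¬ G.Adj x y → ¬ G.Adj y z → ¬ G.Adj x z
  symm : ∀ x y, c x y = c y x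
  free : NoRainbowFourCycle G c
  two : ∀ v ∈ S, ∃ u w, IsExclusiveEdge G c S v u ∧ IsExclusiveEdge G c S v w ∧ c v u ≠ c v w

namespace HasTwoExclusiveColors

variable (H : HasTwoExclusiveColors G c S)
include H

theorem exists_ne_color {v : V} (hv : v ∈ S) (k : K) :
    ∃ u, IsExclusiveEdge G c S v u ∧ c v u ≠ k := by
  obtain ⟨u, w, hu, hw, hne⟩ := H.two v hv
  by_cases h : c v u = k
  · exact ⟨w, hw, fun h' => hne (h.trans h'.symm)⟩
  · exact ⟨u, hu, h⟩

/-- Otherwise `x u v w` is a rainbow 4-cycle: the colors of `vu` and `vw` only occur at `v`, and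
that of `ux` only at `u`, so `wx` has none of them. -/
theorem not_adj_of_colors {v u w x : V} (hu : IsExclusiveEdge G c S v u)
    (hw : IsExclusiveEdge G c S v w) (hne : c v u ≠ c v w) (hx : IsExclusiveEdge G c S u x)
    (hxc : c u x ≠ c v u) : ¬ G.Adj x w := by
  intro hadj
  obtain ⟨hvS, huS, hvu, hvex⟩ := hu
  obtain ⟨-, hwS, hvw, hwex⟩ := hw
  obtain ⟨-, hxS, hux, hxex⟩ := hx
  have hs := H.symm
  have hxv : x ≠ v := by rintro rfl; exact hxc (hs _ _)
  have huw : u ≠ w := by rintro rfl; exact hne rfl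
  have h1 := hvex w hwS x hxS hadj.symm
  have h2 := hwex w hwS x hxS hadj.symm
  have h3 := hxex w hwS x hxS hadj.symm
  have h4 := hwex u huS x hxS hux
  have := H.free x u v w hux.symm hvu.symm hvw hadj.symm hxv huw
  have e1 := hs x u
  have e2 := hs u v
  have := hvw.ne
  have := hvu.ne
  have := hux.ne
  grind

/-- An exclusive neighbor `x` of `u` is adjacent to `u` but not to `w`; transitivity of nonadjacency
does the rest. -/
theorem adj_of_colors {v u w : V} (hu : IsExclusiveEdge G c S v u)
    (hw : IsExclusiveEdge G c S v w) (hne : c v u ≠ c v w) : G.Adj u w := by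
  obtain ⟨x, hx, hxc⟩ := H.exists_ne_color hu.2.1 (c v u)
  by_contra h
  exact H.trans u w x h (fun h' => H.not_adj_of_colors hu hw hne hx hxc h'.symm) hx.2.2.1

/-- If `uv` is not exclusive at `u`, both exclusive edges `ux`, `uy` differ in color from `vu`. Then
`x` and `y` are both nonadjacent to another exclusive neighbor `w` of `v`, hence to each other,
against `adj_of_colors`. -/
theorem exclusive_symm {v u : V} (hu : IsExclusiveEdge G c S v u) :
    IsExclusiveEdge G c S u v := by
  by_contra hn
  obtain ⟨w, hw, hwc⟩ := H.exists_ne_color hu.1 (c v u)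
  obtain ⟨x, y, hx, hy, hxy⟩ := H.two u hu.2.1
  have key : ∀ z, IsExclusiveEdge G c S u z → c u z ≠ c v u := by
    intro z hz hc
    refine hn ⟨hu.2.1, hu.1, hu.2.2.1.symm, fun a ha b hb hab he => hz.2.2.2 a ha b hb hab ?_⟩
    rw [he, H.symm u v, hc]
  have h1 := H.not_adj_of_colors hu hw hwc.symm hx (key x hx)
  have h2 := H.not_adj_of_colors hu hw hwc.symm hy (key y hy)
  exact H.trans x w y h1 (fun h => h2 h.symm) (H.adj_of_colors hx hy hxy)

/-- The color of an exclusive edge occurs on no other edge. -/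
theorem unique_color {v u x y : V} (hu : IsExclusiveEdge G c S v u) (hx : x ∈ S) (hy : y ∈ S)
    (hxy : G.Adj x y) (hc : c x y = c v u) : (x = v ∧ y = u) ∨ (x = u ∧ y = v) := by
  have h1 := hu.2.2.2 x hx y hy hxy hc
  have h2 := (H.exclusive_symm hu).2.2.2 x hx y hy hxy (hc.trans (H.symm _ _))
  have := hu.2.2.1.ne
  have := hxy.ne
  grind

theorem color_ne {v u w : V} (hu : IsExclusiveEdge G c S v u)
    (hw : IsExclusiveEdge G c S v w) (hne : u ≠ w) : c v u ≠ c v w := by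
  intro h
  have := H.unique_color hu hw.1 hw.2.1 hw.2.2.1 h.symm
  have := hw.2.2.1.ne
  grind

theorem adj_of_ne {v u w : V} (hu : IsExclusiveEdge G c S v u)
    (hw : IsExclusiveEdge G c S v w) (hne : u ≠ w) : G.Adj u w :=
  H.adj_of_colors hu hw (H.color_ne hu hw hne)

/-- The ends of a path of exclusive edges with four vertices, in the order `w v u x`, are not
adjacent. -/
theorem not_adj_ends {v u w x : V} (hu : IsExclusiveEdge G c S v u)
    (hw : IsExclusiveEdge G c S v w) (hne : u ≠ w) (hx : IsExclusiveEdge G c S u x)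
    (hxv : x ≠ v) : ¬ G.Adj x w := by
  refine H.not_adj_of_colors hu hw (H.color_ne hu hw hne) hx ?_
  rw [H.symm v u]
  exact H.color_ne hx (H.exclusive_symm hu) hxv

/-- The next vertex `x` after `u` is nonadjacent to `w` and to a third exclusive neighbor `z`, so
`w` and `z` would be nonadjacent. -/
theorem eq_or_eq {v u w z : V} (hu : IsExclusiveEdge G c S v u)
    (hw : IsExclusiveEdge G c S v w) (hne : u ≠ w) (hz : IsExclusiveEdge G c S v z) :
    z = u ∨ z = w := by
  by_contra h
  push Not at h
  obtain ⟨x, hx, hxc⟩ := H.exists_ne_color hu.2.1 (c v u)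
  have h1 := H.not_adj_of_colors hu hw (H.color_ne hu hw hne) hx hxc
  have h2 := H.not_adj_of_colors hu hz (H.color_ne hu hz (Ne.symm h.1)) hx hxc
  exact H.trans z x w (fun h => h2 h.symm) h1 (H.adj_of_ne hz hw h.2)

theorem exists_other {v u : V} (hu : IsExclusiveEdge G c S v u) :
    ∃ w, IsExclusiveEdge G c S v w ∧ w ≠ u := by
  obtain ⟨w, hw, hne⟩ := H.exists_ne_color hu.1 (c v u)
  exact ⟨w, hw, by rintro rfl; exact hne rfl⟩

/-- Every vertex is adjacent to an exclusive neighbor of every vertex. -/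
theorem exists_exclusive_adj {w : V} (hw : w ∈ S) (y : V) :
    ∃ w', IsExclusiveEdge G c S w w' ∧ G.Adj w' y := by
  obtain ⟨a, b, ha, hb, hne⟩ := H.two w hw
  by_cases h : G.Adj a y
  · exact ⟨a, ha, h⟩
  · refine ⟨b, hb, ?_⟩
    by_contra h'
    exact H.trans a y b h (fun h => h' h.symm) (H.adj_of_colors ha hb hne)

/-- Moving both ends of an edge along exclusive edges keeps its color. -/
theorem color_move {x w x' w' : V} (hx : IsExclusiveEdge G c S x x')
    (hw : IsExclusiveEdge G c S w w') (hxw : G.Adj x w) (hxw' : G.Adj x' w')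
    (h1 : x ≠ w') (h2 : x' ≠ w) : c x' w' = c x w := by
  have hs := H.symm
  -- The colors of `xx'` and `ww'` occur on no other edge, so only the two remaining edges of this
  -- 4-cycle can agree.
  have hf := H.free x w w' x' hxw hw.2.2.1 hxw'.symm hx.2.2.1.symm h1 h2.symm
  have a1 := H.unique_color hx hx.1 hw.1 hxw
  have a2 := H.unique_color hw hx.1 hw.1 hxw
  have a3 := H.unique_color hx hx.2.1 hw.2.1 hxw'
  have a4 := H.unique_color hw hx.2.1 hw.2.1 hxw'
  have a5 := H.unique_color hx hw.1 hw.2.1 hw.2.2.1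
  have e1 := hs w' x'
  have e2 := hs x' x
  have := hxw.ne
  have := hxw'.ne
  grind

end HasTwoExclusiveColors

end RainbowFourCycles

/-! ### Colors lost with a path or a triangle of exclusive edges. -/

section RainbowFourCycles

variable {V K : Type*} {G : SimpleGraph V} {c : V → V → K} {S : Finset V}

namespace HasTwoExclusiveColors

section Path

variable (H : HasTwoExclusiveColors G c S) {p v₀ v₁ v₂ q : V}
  (hp : IsExclusiveEdge G c S v₀ p) (h₀ : IsExclusiveEdge G c S v₀ v₁)
  (h₂ : IsExclusiveEdge G c S v₂ v₁) (hq : IsExclusiveEdge G c S v₂ q)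
  (h02 : v₀ ≠ v₂) (hp1 : p ≠ v₁) (hq1 : q ≠ v₁) (hp2 : p ≠ v₂) (hq0 : q ≠ v₀)
include H hp h₀ h₂ h02 hp1

/-- Exclusive edges form no 4-cycle: the ends of `p v₀ v₁ v₂` are not adjacent. -/
theorem outer_ne (hq : IsExclusiveEdge G c S v₂ q) : p ≠ q := by
  rintro rfl
  exact H.not_adj_ends h₀ hp hp1.symm (H.exclusive_symm h₂) h02.symm hq.2.2.1

include hp2

/-- `color_move` carries `v₀w` to `pw'`, where `w'` is an exclusive neighbor of `w` adjacent to `p`;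
it is not `v₂` because `v₂` and `p` are nonadjacent. -/
theorem exists_color_off_path_of_end {w : V} (hw : w ∈ S) (hadj : G.Adj v₀ w)
    (hw1 : w ≠ v₁) (hw2 : w ≠ v₂) (hwp : w ≠ p) :
    ∃ y ∈ S, ∃ z ∈ S, G.Adj y z ∧ c y z = c v₀ w ∧
      (y ≠ v₀ ∧ y ≠ v₁ ∧ y ≠ v₂) ∧ (z ≠ v₀ ∧ z ≠ v₁ ∧ z ≠ v₂) := by
  have hp2n : ¬ G.Adj v₂ p :=
    H.not_adj_ends h₀ hp hp1.symm (H.exclusive_symm h₂) h02.symm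
  obtain ⟨w', hw', hadj'⟩ := H.exists_exclusive_adj hw p
  have hs := H.exclusive_symm hw'
  have n0 : w' ≠ v₀ := by
    rintro rfl
    have := H.eq_or_eq hp h₀ hp1 hs
    tauto
  have n1 : w' ≠ v₁ := by
    rintro rfl
    have := H.eq_or_eq (H.exclusive_symm h₀) (H.exclusive_symm h₂) h02 hs
    have := hadj.ne
    grind
  have n2 : w' ≠ v₂ := by
    rintro rfl
    exact hp2n hadj'
  have := hp.2.2.1.ne
  exact ⟨p, hp.2.1, w', hw'.2.1, hadj'.symm,
    H.color_move hp hw' hadj hadj'.symm n0.symm hwp.symm, ⟨this.symm, hp1, hp2⟩, n0, n1, n2⟩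

include hq hq1

/-- `color_move` carries `v₁w` to an edge `v₀w'`, to which the result for an end applies; `w ≠ q`
ensures `w' ≠ v₂`. -/
theorem exists_color_off_path_of_middle_of_ne {w : V} (hw : w ∈ S) (hadj : G.Adj v₁ w)
    (hw0 : w ≠ v₀) (hw2 : w ≠ v₂) (hwq : w ≠ q) :
    ∃ y ∈ S, ∃ z ∈ S, G.Adj y z ∧ c y z = c v₁ w ∧
      (y ≠ v₀ ∧ y ≠ v₁ ∧ y ≠ v₂) ∧ (z ≠ v₀ ∧ z ≠ v₁ ∧ z ≠ v₂) := by
  obtain ⟨w', hw', hadj'⟩ := H.exists_exclusive_adj hw v₀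
  have hs := H.exclusive_symm hw'
  have n1 : w' ≠ v₁ := by
    rintro rfl
    have := H.eq_or_eq (H.exclusive_symm h₀) (H.exclusive_symm h₂) h02 hs
    tauto
  have n2 : w' ≠ v₂ := by
    rintro rfl
    have := H.eq_or_eq hq h₂ hq1 hs
    have := hadj.ne
    grind
  have hc := H.color_move (H.exclusive_symm h₀) hw' hadj hadj'.symm n1.symm hw0.symm
  rw [← hc]
  refine H.exists_color_off_path_of_end hp h₀ h₂ h02 hp1 hp2 hw'.2.1 hadj'.symm n1 n2 ?_
  rintro rfl
  have := H.unique_color hp h₀.2.1 hw hadj hc.symm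
  have := h₀.2.2.1.ne
  grind

include hq0

theorem exists_color_off_path_of_middle {w : V} (hw : w ∈ S) (hadj : G.Adj v₁ w)
    (hw0 : w ≠ v₀) (hw2 : w ≠ v₂) :
    ∃ y ∈ S, ∃ z ∈ S, G.Adj y z ∧ c y z = c v₁ w ∧
      (y ≠ v₀ ∧ y ≠ v₁ ∧ y ≠ v₂) ∧ (z ≠ v₀ ∧ z ≠ v₁ ∧ z ≠ v₂) := by
  have hpq := H.outer_ne hp h₀ h₂ h02 hp1 hq
  -- Since `p ≠ q`, the vertex `w` differs from one of them; if `w = q`, the path is reversed.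
  by_cases hwq : w = q
  · obtain ⟨y, hy, z, hz, h⟩ := H.exists_color_off_path_of_middle_of_ne hq h₂ h₀ hp h02.symm hq1
      hp1 hq0 hw hadj hw2 hw0 (by rw [hwq]; exact hpq.symm)
    exact ⟨y, hy, z, hz, by tauto⟩
  · exact H.exists_color_off_path_of_middle_of_ne hp h₀ h₂ hq h02 hp1 hq1 hp2 hw hadj hw0 hw2
      hwq

/-- A color on an edge at the path `v₀v₁v₂` of exclusive edges, other than the colors of the four
exclusive edges there, also occurs on an edge away from the path. -/
theorem exists_color_off_path {x w : V} (hw : w ∈ S) (hadj : G.Adj x w)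
    (hxT : x = v₀ ∨ x = v₁ ∨ x = v₂) (k0 : c x w ≠ c v₀ p) (k1 : c x w ≠ c v₀ v₁)
    (k2 : c x w ≠ c v₂ v₁) (k3 : c x w ≠ c v₂ q) :
    ∃ y ∈ S, ∃ z ∈ S, G.Adj y z ∧ c y z = c x w ∧
      (y ≠ v₀ ∧ y ≠ v₁ ∧ y ≠ v₂) ∧ (z ≠ v₀ ∧ z ≠ v₁ ∧ z ≠ v₂) := by
  have hs := H.symm
  -- The chord `v₀v₂` moves to `pv₁`, an edge at the middle vertex.
  have chord : ∃ y ∈ S, ∃ z ∈ S, G.Adj y z ∧ c y z = c v₀ v₂ ∧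
      (y ≠ v₀ ∧ y ≠ v₁ ∧ y ≠ v₂) ∧ (z ≠ v₀ ∧ z ≠ v₁ ∧ z ≠ v₂) := by
    have hp1' := H.adj_of_ne hp h₀ hp1
    have h02' := H.adj_of_ne (H.exclusive_symm h₀) (H.exclusive_symm h₂) h02
    rw [← H.color_move hp h₂ h02' hp1' h₀.2.2.1.ne hp2, hs p v₁]
    exact H.exists_color_off_path_of_middle hp h₀ h₂ hq h02 hp1 hq1 hp2 hq0 hp.2.1 hp1'.symm
      hp.2.2.1.ne' hp2
  have hne := hadj.ne
  rcases hxT with rfl | rfl | rfl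
  · by_cases hw2 : w = v₂
    · rw [hw2]; exact chord
    · exact H.exists_color_off_path_of_end hp h₀ h₂ h02 hp1 hp2 hw hadj
        (by rintro rfl; exact k1 rfl) hw2 (by rintro rfl; exact k0 rfl)
  · exact H.exists_color_off_path_of_middle hp h₀ h₂ hq h02 hp1 hq1 hp2 hq0 hw hadj
      (by rintro rfl; exact k1 (hs _ _)) (by rintro rfl; exact k2 (hs _ _))
  · by_cases hw0 : w = v₀
    · rw [hw0, hs]; exact chord
    · obtain ⟨y, hy, z, hz, h⟩ := H.exists_color_off_path_of_end hq h₂ h₀ h02.symm hq1 hq0 hw hadj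
        (by rintro rfl; exact k2 rfl) hw0 (by rintro rfl; exact k3 rfl)
      exact ⟨y, hy, z, hz, by tauto⟩

end Path

section Triangle

variable (H : HasTwoExclusiveColors G c S) {T : Finset V} (hT : T.card = 3)
  (hex : ∀ x ∈ T, ∀ y ∈ T, x ≠ y → IsExclusiveEdge G c S x y)
include H hT hex

theorem mem_of_exclusive {x z : V} (hx : x ∈ T) (hz : IsExclusiveEdge G c S x z) : z ∈ T := by
  classical
  have : 1 < (T.erase x).card := by rw [Finset.card_erase_of_mem hx, hT]; norm_num
  obtain ⟨a, ha, b, hb, hab⟩ := Finset.one_lt_card.mp this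
  rw [Finset.mem_erase] at ha hb
  rcases H.eq_or_eq (hex x hx a ha.2 ha.1.symm) (hex x hx b hb.2 hb.1.symm) hab hz with rfl | rfl
  exacts [ha.2, hb.2]

theorem exists_ne_adj (x w : V) : ∃ y ∈ T, y ≠ x ∧ G.Adj y w := by
  classical
  have : 1 < (T.erase x).card := by
    have := Finset.pred_card_le_card_erase (s := T) (a := x)
    omega
  obtain ⟨a, ha, b, hb, hab⟩ := Finset.one_lt_card.mp this
  rw [Finset.mem_erase] at ha hb
  by_cases h : G.Adj a w
  · exact ⟨a, ha.2, ha.1, h⟩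
  · refine ⟨b, hb.2, hb.1, ?_⟩
    by_contra h'
    exact H.trans a w b h (fun h => h' h.symm) (hex a ha.2 b hb.2 hab).2.2.1

/-- In the 4-cycle `x w y z` through the third vertex `z`, the colors of `xz` and `yz` are private.
-/
theorem color_eq_of_triangle {x y w : V} (hx : x ∈ T) (hy : y ∈ T) (hw : w ∈ S) (hwT : w ∉ T)
    (hxw : G.Adj x w) (hyw : G.Adj y w) : c x w = c y w := by
  classical
  by_cases hxy : x = y
  · rw [hxy]
  obtain ⟨z, hz, hzx, hzy⟩ : ∃ z ∈ T, z ≠ x ∧ z ≠ y := by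
    have h1 := Finset.pred_card_le_card_erase (s := T.erase x) (a := y)
    have h2 := Finset.pred_card_le_card_erase (s := T) (a := x)
    obtain ⟨z, hz⟩ := Finset.card_pos.mp (show 0 < ((T.erase x).erase y).card by omega)
    simp only [Finset.mem_erase] at hz
    exact ⟨z, hz.2.2, hz.2.1, hz.1⟩
  have ex := hex x hx z hz hzx.symm
  have ey := hex y hy z hz hzy.symm
  have hwz : w ≠ z := by rintro rfl; exact hwT hz
  have hf := H.free x w y z hxw hyw.symm ey.2.2.1 ex.2.2.1.symm hxy hwz
  have a1 := H.unique_color ex ex.1 hw hxw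
  have a2 := H.unique_color ey ex.1 hw hxw
  have a3 := H.unique_color ex ey.1 hw hyw
  have a4 := H.unique_color ey ey.1 hw hyw
  have a5 := H.unique_color ey ex.1 ex.2.1 ex.2.2.1
  have e1 := H.symm w y
  have e2 := H.symm z x
  have := hxw.ne
  have := hyw.ne
  grind

/-- At most one color of an edge leaving a triangle of exclusive edges only occurs on edges at the
triangle. -/
theorem color_eq_of_leaving {x w y u : V} (hx : x ∈ T) (hw : w ∈ S) (hwT : w ∉ T)
    (hxw : G.Adj x w) (hy : y ∈ T) (hu : u ∈ S) (huT : u ∉ T) (hyu : G.Adj y u)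
    (hcw : ∀ a ∈ S, ∀ b ∈ S, G.Adj a b → c a b = c x w → a ∈ T ∨ b ∈ T)
    (hcu : ∀ a ∈ S, ∀ b ∈ S, G.Adj a b → c a b = c y u → a ∈ T ∨ b ∈ T) : c x w = c y u := by
  -- When `w` and `u` are adjacent, consider the 4-cycle `x w u y'` with `y'` in `T`: the color of
  -- `xy'` is private and that of `wu` occurs off `T`, so the other two edges agree.
  have key : ∀ x w, x ∈ T → w ∈ S → w ∉ T → G.Adj x w →
      (∀ a ∈ S, ∀ b ∈ S, G.Adj a b → c a b = c x w → a ∈ T ∨ b ∈ T) → G.Adj w u →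
      c x w = c y u := by
    intro x w hx hw hwT hxw hcw hwu
    obtain ⟨y', hy', hyx, hyu'⟩ := H.exists_ne_adj hT hex x u
    have hc := H.color_eq_of_triangle hT hex hy hy' hu huT hyu hyu'
    have e := hex x hx y' hy' hyx.symm
    have hxu : x ≠ u := by rintro rfl; exact huT hx
    have hwy : w ≠ y' := by rintro rfl; exact hwT hy'
    have hf := H.free x w u y' hxw hwu hyu'.symm e.2.2.1.symm hxu hwy
    have a1 := H.unique_color e e.1 hw hxw
    have a2 := H.unique_color e e.2.1 hu hyu'
    have a3 := hcw w hw u hu hwu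
    have a4 := hcu w hw u hu hwu
    have a5 := H.unique_color e hw hu hwu
    have e1 := H.symm u y'
    have e2 := H.symm y' x
    grind
  by_cases hwu : G.Adj w u
  · exact key x w hx hw hwT hxw hcw hwu
  -- Moving `xw` along exclusive edges keeps its color and makes its outer end adjacent to `u`.
  · obtain ⟨w', hw', hadj⟩ := H.exists_exclusive_adj hw u
    have hwT' : w' ∉ T := fun h => hwT (H.mem_of_exclusive hT hex h (H.exclusive_symm hw'))
    obtain ⟨x', hx', hne, hxw'⟩ := H.exists_ne_adj hT hex x w'
    have hc : c x' w' = c x w := H.color_move (hex x hx x' hx' hne.symm) hw' hxw hxw'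
      (by rintro rfl; exact hwT' hx) (by rintro rfl; exact hwT hx')
    rw [← hc]
    exact key x' w' hx' hw'.2.1 hwT' hxw' (by rwa [hc]) hadj

end Triangle

end HasTwoExclusiveColors

end RainbowFourCycles

/-! ### Counting colors and the induction for the upper bound. -/

section RainbowFourCycles

variable {V K : Type*} {G : SimpleGraph V} {c : V → V → K} {S : Finset V}

open Classical in
/-- The set of colors of the edges of `G[S]`. -/
noncomputable def colorsOn (G : SimpleGraph V) (c : V → V → K) (S : Finset V) : Finset K :=
  ((S ×ˢ S).filter fun e => G.Adj e.1 e.2).image fun e => c e.1 e.2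

theorem mem_colorsOn {k : K} :
    k ∈ colorsOn G c S ↔ ∃ x ∈ S, ∃ y ∈ S, G.Adj x y ∧ c x y = k := by
  classical
  simp only [colorsOn, Finset.mem_image, Finset.mem_filter, Finset.mem_product, Prod.exists]
  grind

theorem exists_leaving_edge_of_colorsOn [DecidableEq V] {A : Finset V}
    (hs : ∀ x y, c x y = c y x) {k : K} (h : k ∈ colorsOn G c S)
    (h' : k ∉ colorsOn G c (S \ A)) :
    ∃ x ∈ S, ∃ y ∈ S, x ∈ A ∧ G.Adj x y ∧ c x y = k ∧
      ∀ a ∈ S, ∀ b ∈ S, G.Adj a b → c a b = c x y → a ∈ A ∨ b ∈ A := by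
  have key : ∀ a ∈ S, ∀ b ∈ S, G.Adj a b → c a b = k → a ∈ A ∨ b ∈ A := by
    intro a ha b hb hab hk
    by_contra! hn
    exact h' (mem_colorsOn.mpr ⟨a, by simp [ha, hn.1], b, by simp [hb, hn.2], hab, hk⟩)
  obtain ⟨x, hx, y, hy, hxy, rfl⟩ := mem_colorsOn.mp h
  rcases key x hx y hy hxy rfl with hA | hA
  · exact ⟨x, hx, y, hy, hA, hxy, rfl, key⟩
  · exact ⟨y, hy, x, hx, hA, hxy.symm, hs y x, by rwa [hs y x]⟩

/-- Around a vertex and its two exclusive neighbors at most four colors disappear with these three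
vertices; at most three if nothing else is left. -/
theorem HasTwoExclusiveColors.exists_triangle [DecidableEq V] [DecidableEq K]
    (H : HasTwoExclusiveColors G c S) (hS : S.Nonempty) :
    ∃ T ⊆ S, G.IsNClique 3 T ∧ (colorsOn G c S \ colorsOn G c (S \ T)).card ≤ 4 ∧
      (S = T → (colorsOn G c S \ colorsOn G c (S \ T)).card ≤ 3) := by
  obtain ⟨v₁, hv₁⟩ := hS
  obtain ⟨v₀, v₂, h10, h12, hne⟩ := H.two v₁ hv₁
  have h01 := H.exclusive_symm h10
  have h21 := H.exclusive_symm h12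
  have h02a := H.adj_of_colors h10 h12 hne
  have h02 := h02a.ne
  have n01 := h01.2.2.1.ne
  have n21 := h21.2.2.1.ne
  refine ⟨{v₀, v₁, v₂}, ?_, ?_, ?_⟩
  · intro x hx
    simp only [Finset.mem_insert, Finset.mem_singleton] at hx
    rcases hx with rfl | rfl | rfl
    exacts [h01.1, h01.2.1, h21.1]
  · rw [SimpleGraph.is3Clique_triple_iff]
    exact ⟨h01.2.2.1, h02a, h12.2.2.1⟩
  have hcard : ({v₀, v₁, v₂} : Finset V).card = 3 := by
    rw [Finset.card_eq_three]
    exact ⟨v₀, v₁, v₂, n01, h02, n21.symm, rfl⟩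
  set T : Finset V := {v₀, v₁, v₂} with hTdef
  have hmT : ∀ x, x ∈ T ↔ x = v₀ ∨ x = v₁ ∨ x = v₂ := by simp [hTdef]
  -- If the exclusive edges close up to a triangle, its three colors and at most one leaving color
  -- are lost. Otherwise only the four exclusive edges at the path lose their colors.
  by_cases hclosed : IsExclusiveEdge G c S v₀ v₂
  · have hclosed' := H.exclusive_symm hclosed
    have hex : ∀ x ∈ T, ∀ y ∈ T, x ≠ y → IsExclusiveEdge G c S x y := by
      intro x hx y hy hxy
      rw [hmT] at hx hy
      rcases hx with rfl | rfl | rfl <;> rcases hy with rfl | rfl | rfl <;>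
        first
        | exact absurd rfl hxy
        | assumption
    have hin : ∀ x ∈ T, ∀ y ∈ T, G.Adj x y →
        c x y ∈ ({c v₀ v₁, c v₂ v₁, c v₀ v₂} : Finset K) := by
      intro x hx y hy hxy
      have := hxy.ne
      have e1 := H.symm v₀ v₁
      have e2 := H.symm v₂ v₁
      have e3 := H.symm v₀ v₂
      rw [hmT] at hx hy
      simp only [Finset.mem_insert, Finset.mem_singleton]
      grind
    have hle3 : ({c v₀ v₁, c v₂ v₁, c v₀ v₂} : Finset K).card ≤ 3 := Finset.card_le_three
    constructor
    · have hone : ((colorsOn G c S \ colorsOn G c (S \ T)) \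
          {c v₀ v₁, c v₂ v₁, c v₀ v₂}).card ≤ 1 := by
        have leave : ∀ k ∈ (colorsOn G c S \ colorsOn G c (S \ T)) \
            {c v₀ v₁, c v₂ v₁, c v₀ v₂}, ∃ x ∈ T, ∃ w ∈ S, w ∉ T ∧ G.Adj x w ∧ c x w = k ∧
              ∀ a ∈ S, ∀ b ∈ S, G.Adj a b → c a b = c x w → a ∈ T ∨ b ∈ T := by
          intro k hk
          rw [Finset.mem_sdiff, Finset.mem_sdiff] at hk
          obtain ⟨x, -, w, hw, hxT, hxw, hc, hcw⟩ :=
            exists_leaving_edge_of_colorsOn H.symm hk.1.1 hk.1.2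
          refine ⟨x, hxT, w, hw, fun hwT => hk.2 ?_, hxw, hc, hcw⟩
          rw [← hc]
          exact hin x hxT w hwT hxw
        rw [Finset.card_le_one]
        intro k hk l hl
        obtain ⟨x, hx, w, hw, hwT, hxw, rfl, hcw⟩ := leave k hk
        obtain ⟨y, hy, u, hu, huT, hyu, rfl, hcu⟩ := leave l hl
        exact H.color_eq_of_leaving hcard hex hx hw hwT hxw hy hu huT hyu hcw hcu
      have := Finset.card_le_card_sdiff_add_card (t := {c v₀ v₁, c v₂ v₁, c v₀ v₂})
        (s := colorsOn G c S \ colorsOn G c (S \ T))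
      omega
    · intro hST
      refine le_trans (Finset.card_le_card ?_) hle3
      intro k hk
      obtain ⟨x, hx, y, hy, hxy, rfl⟩ := mem_colorsOn.mp (Finset.mem_sdiff.mp hk).1
      rw [hST] at hx hy
      exact hin x hx y hy hxy
  · obtain ⟨p, hp, hp1⟩ := H.exists_other h01
    obtain ⟨q, hq, hq1⟩ := H.exists_other h21
    have hp2 : p ≠ v₂ := by rintro rfl; exact hclosed hp
    have hq0 : q ≠ v₀ := by rintro rfl; exact hclosed (H.exclusive_symm hq)
    constructor
    · have hle : ({c v₀ p, c v₀ v₁, c v₂ v₁, c v₂ q} : Finset K).card ≤ 4 := Finset.card_le_four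
      refine le_trans (Finset.card_le_card ?_) hle
      intro k hk
      rw [Finset.mem_sdiff] at hk
      obtain ⟨x, -, w, hw, hxT, hxw, rfl, -⟩ :=
        exists_leaving_edge_of_colorsOn H.symm hk.1 hk.2
      by_contra hn
      simp only [Finset.mem_insert, Finset.mem_singleton, not_or] at hn
      obtain ⟨y, hy, z, hz, hyz, hc, hyT, hzT⟩ := H.exists_color_off_path hp h01 h21 hq h02 hp1 hq1
        hp2 hq0 hw hxw ((hmT x).mp hxT) hn.1 hn.2.1 hn.2.2.1 hn.2.2.2
      refine hk.2 (mem_colorsOn.mpr ⟨y, ?_, z, ?_, hyz, hc⟩)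
      · rw [Finset.mem_sdiff, hmT]; exact ⟨hy, by tauto⟩
      · rw [Finset.mem_sdiff, hmT]; exact ⟨hz, by tauto⟩
    -- This cannot happen: `p` lies in `S` but not in `T`.
    · intro hST
      have := hp.2.1
      rw [hST, hmT] at this
      have := hp.2.2.1.ne
      grind

/-- Let nonadjacency in `G` be transitive. If `c` has no rainbow 4-cycle, then `G[S]` contains
disjoint triangles whose number is at least the number of colors minus `|S| - 1`. -/
theorem exists_disjoint_triangles_of_colors
    (htrans : ∀ x y z, ¬ G.Adj x y → ¬ G.Adj y z → ¬ G.Adj x z)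
    (hsymm : ∀ x y, c x y = c y x) (hfree : NoRainbowFourCycle G c) :
    ∀ S : Finset V, S.Nonempty → ∃ F : Finset (Finset V), (∀ A ∈ F, A ⊆ S ∧ G.IsNClique 3 A) ∧
      (F : Set (Finset V)).PairwiseDisjoint id ∧ (colorsOn G c S).card + 1 ≤ S.card + F.card := by
  classical
  intro S
  induction S using Finset.strongInduction with
  | H S ih =>
  intro hS
  by_contra! hbig
  have hempty : S.card + 0 < (colorsOn G c S).card + 1 := hbig ∅ (by simp) (by simp)
  have H : HasTwoExclusiveColors G c S := by
    refine ⟨htrans, hsymm, hfree, fun v hv => ?_⟩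
    -- A single vertex spans no color and satisfies the bound with no triangle.
    have hne : (S \ {v}).Nonempty := by
      rw [Finset.nonempty_iff_ne_empty]
      intro h0
      have hsub : S ⊆ {v} := Finset.sdiff_eq_empty_iff_subset.mp h0
      have hc0 : colorsOn G c S = ∅ := by
        rw [Finset.eq_empty_iff_forall_notMem]
        intro k hk
        obtain ⟨x, hx, y, hy, hxy, -⟩ := mem_colorsOn.mp hk
        have h1 := Finset.mem_singleton.mp (hsub hx)
        have h2 := Finset.mem_singleton.mp (hsub hy)
        exact hxy.ne (h1.trans h2.symm)
      have := Finset.card_pos.mpr hS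
      rw [hc0, Finset.card_empty] at hempty
      omega
    have hss : S \ {v} ⊂ S := Finset.sdiff_ssubset (by simpa using hv) (by simp)
    obtain ⟨F, hF, hFd, hFc⟩ := ih _ hss hne
    have hF' := hbig F (fun A hA => ⟨(hF A hA).1.trans hss.1, (hF A hA).2⟩) hFd
    have h1 : (S \ {v}).card + 1 = S.card := by
      rw [Finset.sdiff_singleton_eq_erase]; exact Finset.card_erase_add_one hv
    have h2 := Finset.le_card_sdiff (colorsOn G c (S \ {v})) (colorsOn G c S)
    obtain ⟨k, hk, l, hl, hkl⟩ := Finset.one_lt_card.mp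
      (show 1 < (colorsOn G c S \ colorsOn G c (S \ {v})).card by omega)
    have excl : ∀ k ∈ colorsOn G c S \ colorsOn G c (S \ {v}),
        ∃ u, IsExclusiveEdge G c S v u ∧ c v u = k := by
      intro k hk
      rw [Finset.mem_sdiff] at hk
      obtain ⟨x, hx, u, hu, hxA, hxu, hc, hex⟩ := exists_leaving_edge_of_colorsOn hsymm hk.1 hk.2
      obtain rfl := Finset.mem_singleton.mp hxA
      exact ⟨u, ⟨hx, hu, hxu, by simpa using hex⟩, hc⟩
    obtain ⟨u, hu, rfl⟩ := excl k hk
    obtain ⟨w, hw, rfl⟩ := excl l hl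
    exact ⟨u, w, hu, hw, hkl⟩
  obtain ⟨T, hTS, hT, h4, h3⟩ := H.exists_triangle hS
  have hle := Finset.le_card_sdiff (colorsOn G c (S \ T)) (colorsOn G c S)
  have hcardT := Finset.card_sdiff_add_card_eq_card hTS
  have hT3 := hT.card_eq
  by_cases hST : S = T
  -- The induction hypothesis does not cover the empty set, so here the sharper bound of three lost
  -- colors is needed.
  · have h1 := hbig {T} (by simpa using ⟨hTS, hT⟩) (by simp)
    have h0 : colorsOn G c (S \ T) = ∅ := by rw [hST]; simp [colorsOn]
    have := h3 hST
    rw [h0, Finset.card_empty] at hle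
    rw [h0] at this
    rw [Finset.card_singleton] at h1
    rw [hST] at h1 this hle
    omega
  · have hne : (S \ T).Nonempty := by
      rw [Finset.sdiff_nonempty]
      exact fun h => hST (h.antisymm hTS)
    have hTne : T.Nonempty := Finset.card_pos.mp (by omega)
    obtain ⟨F, hF, hFd, hFc⟩ := ih _ (Finset.sdiff_ssubset hTS hTne) hne
    have hTF : T ∉ F := by
      intro h
      obtain ⟨x, hx⟩ := hTne
      exact (Finset.mem_sdiff.mp ((hF T h).1 hx)).2 hx
    have h1 := hbig (insert T F) (by
        intro A hA
        rcases Finset.mem_insert.mp hA with rfl | hA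
        · exact ⟨hTS, hT⟩
        · exact ⟨(hF A hA).1.trans Finset.sdiff_subset, (hF A hA).2⟩) (by
        rw [Finset.coe_insert]
        refine hFd.insert fun A hA _ => ?_
        exact Finset.disjoint_sdiff.mono_right (hF A hA).1)
    rw [Finset.card_insert_of_notMem hTF] at h1
    omega

end RainbowFourCycles

/-! ### Translation to edge labelings, and the extremal coloring. -/

section Labelings

variable {V K : Type*} {G : SimpleGraph V}

/-- The edge of the 4-cycle between `i` and `i + 1`. -/
def fourCycleEdge (i : Fin 4) : (SimpleGraph.cycleGraph 4).edgeSet :=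
  ⟨s(i, i + 1), by
    rw [SimpleGraph.mem_edgeSet, SimpleGraph.cycleGraph_adj]
    exact Or.inr (by simp)⟩

theorem fourCycleEdge_injective : Function.Injective fourCycleEdge := by
  intro i j h
  have h' : s(i, i + 1) = s(j, j + 1) := congrArg Subtype.val h
  revert i j
  decide

theorem fourCycleEdge_surjective : Function.Surjective fourCycleEdge := by
  rintro ⟨e, he⟩
  induction e using Sym2.inductionOn with
  | hf i j =>
  rw [SimpleGraph.mem_edgeSet, SimpleGraph.cycleGraph_adj] at he
  rcases he with h | h
  · refine ⟨j, Subtype.ext ?_⟩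
    rw [sub_eq_iff_eq_add'] at h
    subst h
    exact Sym2.eq_swap
  · refine ⟨i, Subtype.ext ?_⟩
    rw [sub_eq_iff_eq_add'] at h
    subst h
    rfl

theorem exists_coloring_of_hasRainbowFreeColoring [Fintype V] {k : ℕ}
    (h : HasRainbowFreeColoring G (SimpleGraph.cycleGraph 4) k) :
    ∃ c : V → V → Option (Fin k), (∀ x y, c x y = c y x) ∧ NoRainbowFourCycle G c ∧
      k ≤ (colorsOn G c Finset.univ).card := by
  classical
  obtain ⟨C, hsurj, hC⟩ := h
  -- The value `none` only fills in non-edges and does not count as a color.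
  refine ⟨fun x y => if h : G.Adj x y then some (C.get x y h) else none, ?_, ?_, ?_⟩
  · intro x y
    by_cases h : G.Adj x y
    · simp only [h, h.symm, dif_pos]
      rw [C.get_comm]
    · have h' : ¬ G.Adj y x := fun h' => h h'.symm
      simp only [h, h', dif_neg, not_false_eq_true]
  · intro a b x d hab hbx hxd hda hax hbd
    simp only [hab, hbx, hxd, hda, dif_pos, Option.some.injEq]
    by_contra! hn
    have hinj : Function.Injective ![a, b, x, d] := by
      intro i j hij
      have := hab.ne
      have := hbx.ne
      have := hxd.ne
      have := hda.ne
      fin_cases i <;> fin_cases j <;> simp_all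
    have hadj : ∀ i j, (SimpleGraph.cycleGraph 4).Adj i j →
        G.Adj (![a, b, x, d] i) (![a, b, x, d] j) := by
      have step : ∀ i, G.Adj (![a, b, x, d] i) (![a, b, x, d] (i + 1)) := by
        intro i
        fin_cases i
        exacts [hab, hbx, hxd, hda]
      intro i j hij
      rw [SimpleGraph.cycleGraph_adj] at hij
      rcases hij with h | h <;> rw [sub_eq_iff_eq_add'] at h <;> rw [h]
      · exact (step j).symm
      · exact step i
    let f : SimpleGraph.Copy (SimpleGraph.cycleGraph 4) G := ⟨⟨![a, b, x, d], @hadj⟩, hinj⟩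
    refine hC f ?_
    have hval : ∀ i, C (f.mapEdgeSet (fourCycleEdge i)) =
        ![C.get a b hab, C.get b x hbx, C.get x d hxd, C.get d a hda] i := by
      intro i
      fin_cases i <;> rfl
    intro e e' hee
    obtain ⟨i, rfl⟩ := fourCycleEdge_surjective e
    obtain ⟨j, rfl⟩ := fourCycleEdge_surjective e'
    simp only [hval] at hee
    congr 1
    fin_cases i <;> fin_cases j <;> simp_all
  · have himg : (Finset.univ : Finset (Fin k)).image some ⊆ colorsOn G
        (fun x y => if h : G.Adj x y then some (C.get x y h) else none) Finset.univ := by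
      intro o ho
      obtain ⟨i, -, rfl⟩ := Finset.mem_image.mp ho
      obtain ⟨⟨e, he⟩, rfl⟩ := hsurj i
      induction e using Sym2.inductionOn with
      | hf x y =>
      have hxy : G.Adj x y := he
      exact mem_colorsOn.mpr ⟨x, Finset.mem_univ _, y, Finset.mem_univ _, hxy, by
        simp only [hxy, dif_pos]; rfl⟩
    have := Finset.card_le_card himg
    rwa [Finset.card_image_of_injective _ (Option.some_injective _), Finset.card_univ,
      Fintype.card_fin] at this

theorem hasRainbowFreeColoring_of_coloring [Fintype V] {c : V → V → K}
    (hsymm : ∀ x y, c x y = c y x) (hfree : NoRainbowFourCycle G c) :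
    HasRainbowFreeColoring G (SimpleGraph.cycleGraph 4) (colorsOn G c Finset.univ).card := by
  have hmem : ∀ x y, G.Adj x y → c x y ∈ colorsOn G c Finset.univ := fun x y h =>
    mem_colorsOn.mpr ⟨x, Finset.mem_univ _, y, Finset.mem_univ _, h, rfl⟩
  let e := (colorsOn G c Finset.univ).equivFin
  let C : G.EdgeLabeling (Fin (colorsOn G c Finset.univ).card) :=
    SimpleGraph.EdgeLabeling.mk (fun x y h => e ⟨c x y, hmem x y h⟩)
      (fun x y h => by simp only [hsymm x y])
  have hget : ∀ x y (h : G.Adj x y), C ⟨s(x, y), h⟩ = e ⟨c x y, hmem x y h⟩ := fun _ _ _ => rfl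
  refine ⟨C, ?_, ?_⟩
  · intro i
    obtain ⟨x, -, y, -, hxy, hc⟩ := mem_colorsOn.mp (e.symm i).2
    refine ⟨⟨s(x, y), hxy⟩, ?_⟩
    rw [hget, ← e.apply_symm_apply i]
    exact congrArg e (Subtype.ext hc)
  · intro f hf
    have hadj : ∀ i : Fin 4, G.Adj (f i) (f (i + 1)) := fun i =>
      f.toHom.map_adj (fourCycleEdge i).2
    have hne : ∀ i j : Fin 4, i ≠ j → f i ≠ f j := fun i j hij h => hij (f.injective h)
    have key : ∀ i j : Fin 4, c (f i) (f (i + 1)) = c (f j) (f (j + 1)) → i = j := by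
      intro i j h
      refine fourCycleEdge_injective (hf ?_)
      change C ⟨s(f i, f (i + 1)), hadj i⟩ = C ⟨s(f j, f (j + 1)), hadj j⟩
      rw [hget, hget]
      exact congrArg e (Subtype.ext h)
    rcases hfree (f 0) (f 1) (f 2) (f 3) (hadj 0) (hadj 1) (hadj 2) (hadj 3)
        (hne 0 2 (by decide)) (hne 1 3 (by decide)) with h | h | h | h | h | h
    · exact absurd (key 0 1 h) (by decide)
    · exact absurd (key 0 2 h) (by decide)
    · exact absurd (key 0 3 h) (by decide)
    · exact absurd (key 1 2 h) (by decide)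
    · exact absurd (key 1 3 h) (by decide)
    · exact absurd (key 2 3 h) (by decide)

/-- If nonadjacency in `G` is transitive and `G` has `s ≥ 1` disjoint triangles, then some coloring
with at least `|V| + s - 1` colors has no rainbow 4-cycle. -/
theorem exists_coloring_of_disjoint_triangles [Fintype V]
    (htrans : ∀ x y z, ¬ G.Adj x y → ¬ G.Adj y z → ¬ G.Adj x z) {s : ℕ} (hs : 1 ≤ s)
    (hT : HasDisjointTriangles G s) :
    ∃ c : V → V → Finset V, (∀ x y, c x y = c y x) ∧ NoRainbowFourCycle G c ∧
      Fintype.card V + s - 1 ≤ (colorsOn G c Finset.univ).card := by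
  classical
  obtain ⟨T, hTs, hclique, hdisj⟩ := hT
  obtain ⟨A₀, hA₀⟩ := Finset.card_pos.mp (show 0 < T.card by omega)
  have hcomp : ∀ v, ∃ B : Finset V, v ∈ B ∧ (B ∈ T ∨ (B = {v} ∧ ∀ A ∈ T, v ∉ A)) := by
    intro v
    by_cases h : ∃ A ∈ T, v ∈ A
    · obtain ⟨A, hA, hv⟩ := h
      exact ⟨A, hv, Or.inl hA⟩
    · push Not at h
      exact ⟨{v}, by simp, Or.inr ⟨rfl, h⟩⟩
  choose comp hmem hcomp using hcomp
  have huniq : ∀ A ∈ T, ∀ B ∈ T, ∀ v, v ∈ A → v ∈ B → A = B := by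
    intro A hA B hB v hvA hvB
    by_contra hne
    exact Finset.disjoint_left.mp (hdisj hA hB hne) hvA hvB
  have hcompT : ∀ A ∈ T, ∀ v ∈ A, comp v = A := by
    intro A hA v hv
    rcases hcomp v with h | h
    · exact huniq _ h _ hA v (hmem v) hv
    · exact absurd hv (h.2 A hA)
  have hcard : ∀ v, (comp v).card ≤ 3 := by
    intro v
    rcases hcomp v with h | h
    · exact (hclique _ h).card_eq.le
    · rw [h.1]; simp
  -- The rank of a block; `A₀` is placed above every value of `equivFin`.
  let ρ : Finset V → ℕ := fun B =>
    if B = A₀ then Fintype.card (Finset V) else (Fintype.equivFin (Finset V) B : ℕ)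
  have hlt : ∀ B, B ≠ A₀ → ρ B < ρ A₀ := by
    intro B hB
    simp only [ρ, hB, if_true, if_false]
    exact Fin.isLt _
  have hρ : Function.Injective ρ := by
    intro A B h
    by_cases hA : A = A₀ <;> by_cases hB : B = A₀
    · rw [hA, hB]
    · have := hlt B hB; rw [← hA] at this; omega
    · have := hlt A hA; rw [← hB] at this; omega
    · simp only [ρ, hA, hB, if_false] at h
      exact (Fintype.equivFin (Finset V)).injective (Fin.ext h)
  -- An edge inside a triangle is colored by the singleton of the opposite vertex, an edge between
  -- blocks by the block of lower rank.
  let c : V → V → Finset V := fun x y =>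
    if comp x = comp y then comp x \ {x, y} else
      if ρ (comp x) ≤ ρ (comp y) then comp x else comp y
  have hlow : ∀ x y, comp x ≠ comp y → ρ (comp x) ≤ ρ (comp y) → c x y = comp x := by
    intro x y h1 h2
    simp only [c, h1, h2, if_true, if_false]
  have hsymm : ∀ x y, c x y = c y x := by
    intro x y
    by_cases h : comp x = comp y
    · simp only [c, h, if_true, Finset.pair_comm]
    · have : ρ (comp x) ≠ ρ (comp y) := fun h' => h (hρ h')
      simp only [c, h, Ne.symm h, if_false]
      split_ifs <;> first | rfl | omega
  refine ⟨c, hsymm, ?_, ?_⟩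
  · have key : ∀ a b x d, a ≠ b → a ≠ x → a ≠ d → b ≠ x → b ≠ d → x ≠ d →
        ρ (comp a) ≤ ρ (comp b) → ρ (comp a) ≤ ρ (comp x) → ρ (comp a) ≤ ρ (comp d) →
        c a b = c b x ∨ c a b = c x d ∨ c a b = c d a ∨ c b x = c x d ∨ c b x = c d a ∨
          c x d = c d a := by
      intro a b x d hab hax had hbx hbd hxd lb lx ld
      have hnot : ¬ (comp b = comp a ∧ comp x = comp a ∧ comp d = comp a) := by
        rintro ⟨hb, hx, hd⟩
        have hsub : ({a, b, x, d} : Finset V) ⊆ comp a := by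
          intro z hz
          simp only [Finset.mem_insert, Finset.mem_singleton] at hz
          rcases hz with rfl | rfl | rfl | rfl
          · exact hmem _
          · rw [← hb]; exact hmem _
          · rw [← hx]; exact hmem _
          · rw [← hd]; exact hmem _
        have h4 : ({a, b, x, d} : Finset V).card = 4 :=
          Finset.card_eq_four.mpr ⟨a, b, x, d, hab, hax, had, hbx, hbd, hxd, rfl⟩
        have := Finset.card_le_card hsub
        have := hcard a
        omega
      have cross : ∀ u v, comp u = comp a → comp v ≠ comp a → ρ (comp a) ≤ ρ (comp v) →
          c u v = comp a ∧ c v u = comp a := by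
        intro u v hu hv hle
        have := hlow u v (by rw [hu]; exact hv.symm) (by rwa [hu])
        rw [hsymm v u, this, hu]
        exact ⟨rfl, rfl⟩
      -- Whichever of `b`, `x`, `d` share the lowest block with `a`, two edges of the cycle leave
      -- this block and have its color.
      by_cases hb : comp b = comp a <;> by_cases hx : comp x = comp a <;>
        by_cases hd : comp d = comp a
      · exact absurd ⟨hb, hx, hd⟩ hnot
      · have := cross x d hx hd ld; have := cross a d rfl hd ld; grind
      · have := cross b x hb hx lx; have := cross d x hd hx lx; grind
      · have := cross b x hb hx lx; have := cross a d rfl hd ld; grind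
      · have := cross a b rfl hb lb; have := cross x b hx hb lb; grind
      · have := cross a b rfl hb lb; have := cross x b hx hb lb; grind
      · have := cross a b rfl hb lb; have := cross d x hd hx lx; grind
      · have := cross a b rfl hb lb; have := cross a d rfl hd ld; grind
    intro a b x d hab hbx hxd hda hax hbd
    have h1 := key a b x d hab.ne hax hda.ne' hbx.ne hbd hxd.ne
    have h2 := key b x d a hbx.ne hbd hab.ne' hxd.ne hax.symm hda.ne
    have h3 := key x d a b hxd.ne hax.symm hbx.ne' hda.ne hbd.symm hab.ne
    have h4 := key d a b x hda.ne hbd.symm hxd.ne' hab.ne hax hbx.ne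
    rcases le_total (ρ (comp a)) (ρ (comp b)) with hab' | hab' <;>
    rcases le_total (ρ (comp x)) (ρ (comp d)) with hxd' | hxd'
    · rcases le_total (ρ (comp a)) (ρ (comp x)) with h | h
      · exact h1 hab' h (h.trans hxd')
      · have := h3 hxd' h (h.trans hab'); grind
    · rcases le_total (ρ (comp a)) (ρ (comp d)) with h | h
      · exact h1 hab' (h.trans hxd') h
      · have := h4 h (h.trans hab') hxd'; grind
    · rcases le_total (ρ (comp b)) (ρ (comp x)) with h | h
      · have := h2 h (h.trans hxd') hab'; grind
      · have := h3 hxd' (h.trans hab') h; grind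
    · rcases le_total (ρ (comp b)) (ρ (comp d)) with h | h
      · have := h2 (h.trans hxd') h hab'; grind
      · have := h4 (h.trans hab') h hxd'; grind
  -- Every vertex is adjacent to one of two adjacent vertices of `A₀`, so each other block sends an
  -- edge to the last one.
  · have hcross : ∀ v, comp v ≠ A₀ → comp v ∈ colorsOn G c Finset.univ := by
      intro v hv
      obtain ⟨a, b, d, hab, -, -, hA⟩ := SimpleGraph.is3Clique_iff.mp (hclique A₀ hA₀)
      have ha : comp a = A₀ := hcompT A₀ hA₀ a (by simp [hA])
      have hb : comp b = A₀ := hcompT A₀ hA₀ b (by simp [hA])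
      have : ∃ w, comp w = A₀ ∧ G.Adj v w := by
        by_cases h : G.Adj v a
        · exact ⟨a, ha, h⟩
        · refine ⟨b, hb, ?_⟩
          by_contra h'
          exact htrans a v b (fun h'' => h h''.symm) h' hab
      obtain ⟨w, hw, hvw⟩ := this
      refine mem_colorsOn.mpr ⟨v, Finset.mem_univ _, w, Finset.mem_univ _, hvw, ?_⟩
      exact hlow v w (by rwa [hw]) (by rw [hw]; exact (hlt _ hv).le)
    -- The singletons give `|V|` colors, as opposite vertices in triangles or as blocks; the
    -- triangles other than `A₀` give `s - 1` more.
    have hsub : (Finset.univ : Finset V).image singleton ∪ T.erase A₀ ⊆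
        colorsOn G c Finset.univ := by
      intro B hB
      rw [Finset.mem_union, Finset.mem_image, Finset.mem_erase] at hB
      rcases hB with ⟨v, -, rfl⟩ | ⟨hne, hB⟩
      · rcases hcomp v with h | h
        · obtain ⟨x, y, hxy, hxyv⟩ : ∃ x y, G.Adj x y ∧
              (x ∈ comp v ∧ y ∈ comp v ∧ comp v \ {x, y} = {v}) := by
            have hv := hmem v
            obtain ⟨a, b, d, hab, had, hbd, hA⟩ := SimpleGraph.is3Clique_iff.mp (hclique _ h)
            rw [hA] at hv ⊢
            have := hab.ne
            have := had.ne
            have := hbd.ne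
            simp only [Finset.mem_insert, Finset.mem_singleton] at hv
            rcases hv with rfl | rfl | rfl
            · exact ⟨b, d, hbd, by simp, by simp, by ext; simp; grind⟩
            · exact ⟨a, d, had, by simp, by simp, by ext; simp; grind⟩
            · exact ⟨a, b, hab, by simp, by simp, by ext; simp; grind⟩
          refine mem_colorsOn.mpr ⟨x, Finset.mem_univ _, y, Finset.mem_univ _, hxy, ?_⟩
          have hx := hcompT _ h x hxyv.1
          have hy := hcompT _ h y hxyv.2.1
          simp only [c, hx, hy, if_true]
          exact hxyv.2.2
        · rw [← h.1]
          refine hcross v fun h0 => ?_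
          exact h.2 A₀ hA₀ (h0 ▸ hmem v)
      · obtain ⟨v, hv⟩ := Finset.card_pos.mp
          (show 0 < B.card by rw [(hclique B hB).card_eq]; norm_num)
        have := hcompT B hB v hv
        rw [← this] at hne ⊢
        exact hcross v hne
    have hd : Disjoint ((Finset.univ : Finset V).image singleton) (T.erase A₀) := by
      rw [Finset.disjoint_left]
      intro B hB hB'
      obtain ⟨v, -, rfl⟩ := Finset.mem_image.mp hB
      have := (hclique _ (Finset.mem_of_mem_erase hB')).card_eq
      simp at this
    have := Finset.card_le_card hsub
    rw [Finset.card_union_of_disjoint hd, Finset.card_erase_of_mem hA₀, hTs,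
      Finset.card_image_of_injective _ Finset.singleton_injective, Finset.card_univ] at this
    omega

end Labelings

/-! ### Disjoint triangles in complete multipartite graphs. -/

section CompleteMultipartite

variable {r : ℕ} {n : Fin r → ℕ}

theorem completeMultipartite_adj {x y : Σ i : Fin r, Fin (n i)} :
    (completeMultipartite n).Adj x y ↔ x.1 ≠ y.1 := Iff.rfl

theorem card_inter_part_le_one {T : Finset (Σ i : Fin r, Fin (n i))}
    (hT : (completeMultipartite n).IsNClique 3 T) (i : Fin r) :
    (T.filter fun x => x.1 = i).card ≤ 1 := by
  rw [Finset.card_le_one]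
  intro x hx y hy
  rw [Finset.mem_filter] at hx hy
  by_contra hne
  exact completeMultipartite_adj.mp (hT.isClique hx.1 hy.1 hne) (hx.2.trans hy.2.symm)

/-- If every triangle has at least `m` vertices in the parts satisfying `p`, then `s` disjoint
triangles need at least `s * m` vertices in these parts. -/
theorem mul_le_sum_parts {s m : ℕ} (h : HasDisjointTriangles (completeMultipartite n) s)
    (p : Fin r → Prop) [DecidablePred p]
    (hp : ∀ T : Finset (Σ i : Fin r, Fin (n i)), (completeMultipartite n).IsNClique 3 T →
      m ≤ (T.filter fun x => p x.1).card) :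
    s * m ≤ ∑ i with p i, n i := by
  classical
  obtain ⟨F, rfl, hF, hd⟩ := h
  have h1 : F.card * m ≤ ∑ T ∈ F, (T.filter fun x => p x.1).card := by
    rw [← smul_eq_mul]
    exact Finset.card_nsmul_le_sum _ _ _ fun T hT => hp T (hF T hT)
  have h2 : ∑ T ∈ F, (T.filter fun x => p x.1).card =
      (F.biUnion fun T => T.filter fun x => p x.1).card := by
    rw [Finset.card_biUnion]
    intro A hA B hB hAB
    exact (hd hA hB hAB).mono (Finset.filter_subset _ _) (Finset.filter_subset _ _)
  have h3 : (F.biUnion fun T => T.filter fun x => p x.1).card ≤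
      ((Finset.univ.filter p).sigma fun i => (Finset.univ : Finset (Fin (n i)))).card := by
    refine Finset.card_le_card fun x hx => ?_
    simp only [Finset.mem_biUnion, Finset.mem_filter] at hx
    obtain ⟨T, -, -, hx⟩ := hx
    simp [hx]
  rw [Finset.card_sigma] at h3
  simp only [Finset.card_univ, Fintype.card_fin] at h3
  exact (h1.trans_eq h2).trans h3

/-- A triangle meets each part at most once, so it has three vertices in all, at least two outside
the first part and at least one outside the first two. -/
theorem le_triangleParam {s : ℕ} (h : HasDisjointTriangles (completeMultipartite n) s) :
    s ≤ triangleParam n := by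
  refine le_min ?_ (le_min ?_ ?_)
  · rw [Nat.le_div_iff_mul_le (by norm_num)]
    have := mul_le_sum_parts (m := 3) h (fun _ => True) fun T hT => by simp [hT.card_eq]
    simpa using this
  · rw [Nat.le_div_iff_mul_le (by norm_num)]
    refine mul_le_sum_parts h (fun i => 1 ≤ i.val) fun T hT => ?_
    have h0 : (T.filter fun x => ¬ 1 ≤ x.1.val).card ≤ 1 := by
      rw [Finset.card_le_one]
      intro x hx y hy
      rw [Finset.mem_filter] at hx hy
      by_contra hne
      exact completeMultipartite_adj.mp (hT.isClique hx.1 hy.1 hne) (Fin.ext (by omega))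
    have := Finset.card_filter_add_card_filter_not (s := T) fun x => 1 ≤ x.1.val
    rw [hT.card_eq] at this
    omega
  · have := mul_le_sum_parts (m := 1) h (fun i => 2 ≤ i.val) fun T hT => ?_
    · simpa using this
    have h0 : (T.filter fun x => ¬ 2 ≤ x.1.val).card ≤ 2 := by
      have hmaps : Set.MapsTo (fun x : Σ i : Fin r, Fin (n i) => x.1.val)
          (T.filter fun x => ¬ 2 ≤ x.1.val) (Finset.range 2) := by
        intro x hx
        have := (Finset.mem_filter.mp hx).2
        simp only [Finset.coe_range, Set.mem_Iio]
        omega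
      have := Finset.card_le_card_of_injOn _ hmaps (by
        intro x hx y hy hxy
        have hx' := (Finset.mem_filter.mp hx).1
        have hy' := (Finset.mem_filter.mp hy).1
        by_contra hne
        exact completeMultipartite_adj.mp (hT.isClique hx' hy' hne) (Fin.ext hxy))
      simpa using this
    have := Finset.card_filter_add_card_filter_not (s := T) fun x => 2 ≤ x.1.val
    rw [hT.card_eq] at this
    omega

/-- Distinct vertices of the same part are at distance less than the size of this part in the
enumeration of the vertices part by part. -/
theorem finSigmaFinEquiv_lt_add {m : Fin r → ℕ} {x y : Σ i : Fin r, Fin (m i)} (h : x.1 = y.1) :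
    (finSigmaFinEquiv x : ℕ) < finSigmaFinEquiv y + m y.1 := by
  obtain ⟨i, a⟩ := x
  obtain ⟨j, b⟩ := y
  obtain rfl : i = j := h
  rw [finSigmaFinEquiv_apply, finSigmaFinEquiv_apply]
  have := a.isLt
  dsimp only
  omega

/-- In the list of the truncated parts, each part is an interval of length at most `t`. Hence
positions `j`, `j + t`, `j + 2t` lie in different parts, and `j < t` gives disjoint triangles. -/
theorem hasDisjointTriangles_of_le_sum_min {t : ℕ} (h : 3 * t ≤ ∑ i, min (n i) t) :
    HasDisjointTriangles (completeMultipartite n) t := by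
  classical
  let m : Fin r → ℕ := fun i => min (n i) t
  let emb : (Σ i : Fin r, Fin (m i)) → Σ i : Fin r, Fin (n i) :=
    Sigma.map id fun i => Fin.castLE (min_le_left (n i) t)
  have hemb : Function.Injective emb :=
    Function.injective_id.sigma_map fun i => Fin.castLE_injective (min_le_left (n i) t)
  let pos : Fin (∑ i, m i) → Σ i : Fin r, Fin (n i) := fun a => emb (finSigmaFinEquiv.symm a)
  have hpos : Function.Injective pos := hemb.comp finSigmaFinEquiv.symm.injective
  have hadj : ∀ a b : Fin (∑ i, m i), a.val + t ≤ b.val →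
      (completeMultipartite n).Adj (pos a) (pos b) := by
    intro a b hab
    rw [completeMultipartite_adj]
    intro h
    have h1 := finSigmaFinEquiv_lt_add (m := m) (x := finSigmaFinEquiv.symm b)
      (y := finSigmaFinEquiv.symm a) h.symm
    rw [Equiv.apply_symm_apply, Equiv.apply_symm_apply] at h1
    have h2 : m (finSigmaFinEquiv.symm a).1 ≤ t := min_le_right _ _
    omega
  have hlt : ∀ (j : Fin t) (k : ℕ), k ≤ 2 → j.val + k * t < ∑ i, m i := by
    intro j k hk
    have := j.isLt
    have : k * t ≤ 2 * t := Nat.mul_le_mul_right t hk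
    have h' : 3 * t ≤ ∑ i, m i := h
    omega
  let v : Fin t → Fin 3 → Σ i : Fin r, Fin (n i) := fun j k =>
    pos ⟨j.val + k.val * t, hlt j k (by omega)⟩
  have hv : ∀ j j' k k', v j k = v j' k' → j = j' := by
    intro j j' k k' h
    have h1 : j.val + k.val * t = j'.val + k'.val * t := congrArg Fin.val (hpos h)
    have h2 := congrArg (· % t) h1
    simp only [Nat.add_mul_mod_self_right, Nat.mod_eq_of_lt j.isLt, Nat.mod_eq_of_lt j'.isLt] at h2
    exact Fin.ext h2
  let tri : Fin t → Finset (Σ i : Fin r, Fin (n i)) := fun j => {v j 0, v j 1, v j 2}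
  have htri : ∀ j x, x ∈ tri j → ∃ k, v j k = x := by
    intro j x hx
    simp only [tri, Finset.mem_insert, Finset.mem_singleton] at hx
    rcases hx with rfl | rfl | rfl
    exacts [⟨_, rfl⟩, ⟨_, rfl⟩, ⟨_, rfl⟩]
  have hmem : ∀ j, v j 0 ∈ tri j := fun j => by simp [tri]
  have hdisj : ∀ j j', j ≠ j' → Disjoint (tri j) (tri j') := by
    intro j j' hne
    rw [Finset.disjoint_left]
    intro x hx hx'
    obtain ⟨k, rfl⟩ := htri j x hx
    obtain ⟨k', hk'⟩ := htri j' _ hx'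
    exact hne (hv _ _ _ _ hk').symm
  have hinj : Function.Injective tri := by
    intro j j' hjj
    by_contra hne
    exact Finset.disjoint_left.mp (hdisj j j' hne) (hmem j) (hjj ▸ hmem j)
  refine ⟨Finset.univ.image tri, ?_, ?_, ?_⟩
  · rw [Finset.card_image_of_injective _ hinj, Finset.card_univ, Fintype.card_fin]
  · intro A hA
    obtain ⟨j, -, rfl⟩ := Finset.mem_image.mp hA
    rw [SimpleGraph.is3Clique_triple_iff]
    refine ⟨hadj _ _ ?_, hadj _ _ ?_, hadj _ _ ?_⟩ <;> simp <;> omega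
  · intro A hA B hB hAB
    obtain ⟨j, -, rfl⟩ := Finset.mem_image.mp hA
    obtain ⟨j', -, rfl⟩ := Finset.mem_image.mp hB
    exact hdisj j j' fun h => hAB (h ▸ rfl)

/-- If the third part has at least `t` vertices, three parts contribute `t` each. Otherwise only the
first two can be truncated, and the three terms of the minimum serve the cases of zero, one or two
truncated parts. -/
theorem three_mul_triangleParam_le (hr : 3 ≤ r) (hanti : Antitone n) :
    3 * triangleParam n ≤ ∑ i, min (n i) (triangleParam n) := by
  obtain ⟨k, rfl⟩ := Nat.exists_eq_add_of_le' hr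
  have h1 : triangleParam n ≤ (∑ i, n i) / 3 := min_le_left _ _
  have h2 : triangleParam n ≤ (∑ i with 1 ≤ (i : Fin (k + 3)).val, n i) / 2 :=
    (min_le_right _ _).trans (min_le_left _ _)
  have h3 : triangleParam n ≤ ∑ i with 2 ≤ (i : Fin (k + 3)).val, n i :=
    (min_le_right _ _).trans (min_le_right _ _)
  generalize triangleParam n = t at *
  rw [Finset.sum_filter] at h2 h3
  simp only [Fin.sum_univ_succ (n := k + 2), Fin.sum_univ_succ (n := k + 1)] at h1 h2 h3 ⊢
  simp at h1 h2 h3 ⊢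
  have a01 : n 1 ≤ n 0 := hanti (Fin.zero_le _)
  have hsucc : ∀ i : Fin (k + 1), n i.succ.succ ≤ n 1 := fun i => hanti (by
    rw [Fin.le_def]; simp)
  by_cases c2 : t ≤ n (Fin.succ (Fin.succ 0))
  · have := Finset.single_le_sum (f := fun i : Fin (k + 1) => min (n i.succ.succ) t)
      (fun _ _ => Nat.zero_le _) (Finset.mem_univ 0)
    have := hsucc 0
    omega
  · have hrest : ∑ i : Fin (k + 1), min (n i.succ.succ) t = ∑ i : Fin (k + 1), n i.succ.succ := by
      refine Finset.sum_congr rfl fun i _ => min_eq_left ?_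
      have : n i.succ.succ ≤ n (Fin.succ (Fin.succ 0)) :=
        hanti (Fin.succ_le_succ_iff.mpr (Fin.succ_le_succ_iff.mpr (Fin.zero_le i)))
      omega
    rw [hrest]
    omega

/-- The extremal coloring needs a triangle to serve as its last block. -/
theorem one_le_triangleParam (hr : 3 ≤ r) (hpos : ∀ i, 1 ≤ n i) : 1 ≤ triangleParam n := by
  have key : ∀ p : Fin r → Prop, ∀ [DecidablePred p],
      (Finset.univ.filter p).card ≤ ∑ i with p i, n i := by
    intro p _
    rw [Finset.card_eq_sum_ones]
    exact Finset.sum_le_sum fun i _ => hpos i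
  obtain ⟨k, rfl⟩ := Nat.exists_eq_add_of_le' hr
  have hall := Finset.sum_le_sum fun i (_ : i ∈ (Finset.univ : Finset (Fin (k + 3)))) => hpos i
  have h1 := key fun i => 1 ≤ i.val
  have h2 := key fun i => 2 ≤ i.val
  have c1 : 2 ≤ (Finset.univ.filter fun i : Fin (k + 3) => 1 ≤ i.val).card := by
    rw [← Nat.lt_iff_add_one_le, Finset.one_lt_card]
    exact ⟨⟨1, by omega⟩, by simp, ⟨2, by omega⟩, by simp, by simp⟩
  have c2 : 1 ≤ (Finset.univ.filter fun i : Fin (k + 3) => 2 ≤ i.val).card :=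
    Finset.card_pos.mpr ⟨⟨2, by omega⟩, by simp⟩
  simp only [Finset.sum_const, Finset.card_univ, Fintype.card_fin, smul_eq_mul, mul_one] at hall
  refine le_min ?_ (le_min ?_ ?_)
  · omega
  · omega
  · omega

end CompleteMultipartite

theorem theorem7 (r : ℕ) (hr : 3 ≤ r) (n : Fin r → ℕ) (hanti : Antitone n)
    (hpos : ∀ i, 1 ≤ n i) :
    IsMaxDisjointTriangles (completeMultipartite n) (triangleParam n) ∧
    IsAntiRamseyNumber (completeMultipartite n) (SimpleGraph.cycleGraph 4)
      ((∑ i, n i) + triangleParam n - 1) := by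
  have htri : HasDisjointTriangles (completeMultipartite n) (triangleParam n) :=
    hasDisjointTriangles_of_le_sum_min (three_mul_triangleParam_le hr hanti)
  have hcard : Fintype.card (Σ i : Fin r, Fin (n i)) = ∑ i, n i := by simp
  have htrans : ∀ x y z, ¬ (completeMultipartite n).Adj x y →
      ¬ (completeMultipartite n).Adj y z → ¬ (completeMultipartite n).Adj x z := by
    intro x y z
    simp only [completeMultipartite_adj, not_not]
    exact fun h h' => h.trans h'
  have hupper : ∀ k, HasRainbowFreeColoring (completeMultipartite n) (SimpleGraph.cycleGraph 4) k →
      k ≤ (∑ i, n i) + triangleParam n - 1 := by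
    intro k hk
    obtain ⟨c, hsymm, hfree, hkc⟩ := exists_coloring_of_hasRainbowFreeColoring hk
    have hne : (Finset.univ : Finset (Σ i : Fin r, Fin (n i))).Nonempty :=
      ⟨⟨⟨0, by omega⟩, ⟨0, hpos _⟩⟩, Finset.mem_univ _⟩
    obtain ⟨F, hF, hd, hc⟩ := exists_disjoint_triangles_of_colors htrans hsymm hfree _ hne
    have := le_triangleParam ⟨F, rfl, fun A hA => (hF A hA).2, hd⟩
    rw [Finset.card_univ, hcard] at hc
    omega
  refine ⟨⟨htri, fun s hs => le_triangleParam hs⟩, ?_, hupper⟩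
  obtain ⟨c, hsymm, hfree, hc⟩ :=
    exists_coloring_of_disjoint_triangles htrans (one_le_triangleParam hr hpos) htri
  have hcol := hasRainbowFreeColoring_of_coloring hsymm hfree
  rw [hcard] at hc
  -- The construction only bounds its number of colors from below; the upper bound makes the number
  -- exact.
  rwa [(hupper _ hcol).antisymm hc] at hcol
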